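/- For integers $0\le m\le n$ let $P_{nm}$ denote the associated Legendre function, $P_{nm}(x)=(-1)^m(1-x^2)^{m/2}\frac{d^m}{dx^m}P_n(x)$ for $x\in[-1,1]$, where $P_n$ is the Legendre polynomial of degree $n$, and put $$\widetilde P_{nm}=\sqrt{\frac{2n+1}{4\pi}\,\frac{(n-m)!}{(n+m)!}}\;P_{nm}.$$ Let $\{\xi_n\}_{n\ge 0}$ be a sequence of nonnegative real numbers, let $\{\lambda_m\}_{m\ge 0}$ be a bounded sequence of nonnegative real numbers, and let $\rho:\mathbb{Z}\to\mathbb{R}$ be a stationary correlation function, that is, $\rho(0)=1$ and $(i,j)\mapsto\rho(i-j)$ is symmetric and positive semidefinite. For $n,n'\ge m\ge 0$ put $$f_m(n,n')=\sqrt{\xi_n\xi_{n'}}\,\rho(n-n')\,\lambda_m .$$ Suppose that there are a real number $\beta$, a constant $r>0$ and an $n_0\in\mathbb{N}$ such that $\xi_n\le r\,n^{-\beta}$ for all $n>n_0$. If either (i) $\beta>4$; or (ii) $\beta>2$ and $\rho(h)=\delta_0^h$ for all $h\in\mathbb{Z}$ (Kronecker delta), then, for every $L\in[0,\pi]$, $$\sum_{n,n'=0}^\infty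 f_0(n,n')\widetilde P_{n0}(\cos L)\widetilde P_{n'0}(\cos L)+2\sum_{m=1}^\infty\ \sum_{n,n'=m}^\infty f_m(n,n')\widetilde P_{nm}(\cos L)\widetilde P_{n'm}(\cos L)<\infty ,$$ in the sense that each of the double series over $(n,n')$ converges absolutely, and so does the series over $m$ of their sums. -/

import Mathlib

namespace AxialSymmetry

/-- The Legendre polynomial `P_n`, by Rodrigues' formula. -/
noncomputable def legendre (n : ℕ) : Polynomial ℝ :=
  Polynomial.C (1 / (2 ^ n * (n.factorial : ℝ))) *
    (Polynomial.derivative^[n] ((Polynomial.X ^ 2 - 1) ^ n))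

/-- The associated Legendre function `P_{nm}` on `[-1, 1]`, with the Condon-Shortley phase:
`P_{nm}(x) = (-1)^m (1 - x^2)^{m/2} (d/dx)^m P_n(x)`. -/
noncomputable def assocLegendre (n m : ℕ) (x : ℝ) : ℝ :=
  (-1) ^ m * (√(1 - x ^ 2)) ^ m * (Polynomial.derivative^[m] (legendre n)).eval x

/-- The normalized associated Legendre function, for `m ≤ n`:
`√((2n+1)/(4π) * (n-m)!/(n+m)!) * P_{nm}(x)`. -/
noncomputable def normLegendre (n m : ℕ) (x : ℝ) : ℝ :=
  √((2 * (n : ℝ) + 1) / (4 * Real.pi) *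
    (((n - m).factorial : ℝ) / ((n + m).factorial : ℝ))) * assocLegendre n m x

/-- The term of index `(n, n')`, where `n, n' ≥ m`, of the `m`-th double series of the variance at
latitude `L`, for coefficients `f m n n'`. -/
noncomputable def varianceTerm (f : ℕ → ℕ → ℕ → ℝ) (L : ℝ) (m : ℕ)
    (p : Set.Ici m × Set.Ici m) : ℝ :=
  f m p.1 p.2 * normLegendre p.1 m (Real.cos L) * normLegendre p.2 m (Real.cos L)

/-- The finite-variance summability condition: at every latitude `L ∈ [0, π]`,
`∑_{n,n' ≥ 0} (terms with m = 0) + 2 ∑_{m ≥ 1} ∑_{n,n' ≥ m} (terms with index m)` converges. Each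
double series over `(n, n')` converges unconditionally (equivalently, absolutely), and so does
the series over `m` of the sums of these double series. -/
def FiniteVariance (f : ℕ → ℕ → ℕ → ℝ) : Prop :=
  ∀ L ∈ Set.Icc (0 : ℝ) Real.pi,
    Summable (varianceTerm f L 0) ∧
    (∀ m : ℕ, 1 ≤ m → Summable (varianceTerm f L m)) ∧
    Summable (fun k : ℕ => 2 * ∑' p, varianceTerm f L (k + 1) p)

/-- A stationary correlation function on the integers: `ρ 0 = 1` and the kernel
`(i, j) ↦ ρ (i - j)` is symmetric and positive semidefinite. -/
def IsCorrelation (ρ : ℤ → ℝ) : Prop :=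
  ρ 0 = 1 ∧ (Matrix.of fun i j : ℤ => ρ (i - j)).PosSemidef

/-- The coefficients `f_m(n, n') = √(ξ_n ξ_{n'}) ρ(n - n') lam_m`. -/
noncomputable def spectrum (ξ : ℕ → ℝ) (ρ : ℤ → ℝ) (lam : ℕ → ℝ) (m n n' : ℕ) : ℝ :=
  √(ξ n * ξ n') * ρ ((n : ℤ) - (n' : ℤ)) * lam m

end AxialSymmetry

open Polynomial

namespace AxialSymmetry

/-! By the addition theorem at coinciding points (`sqAssocLegendre_add_sum`), the squares of
`normLegendre n m x` summed over `m` grow at most linearly in `n`. By Tonelli, `w n * normLegendre n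
m x ^ 2` is then summable over `n` and `m` as soon as `(n + 1) * w n` is summable. If `ρ` is a
Kronecker delta, only the diagonal survives: `w = ξ` works, and `β > 2` suffices. Otherwise `|ρ| ≤
1`, and weighted AM-GM separates `n` from `n'`: with `w n = (n + 1) ^ 2 * ξ n` a third moment of `ξ`
is needed, hence `β > 4`. The addition theorem is proved by differentiating in `x`: Legendre's
equation makes the sum over `m` telescope, so the sum is constant and can be read off at `x = 1`. -/

/-- Each derivative of `(X² - 1)ⁿ` solves a second-order differential equation. -/
theorem iterate_derivative_sq_sub_one_pow (n k : ℕ) :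
    ((X : ℝ[X]) ^ 2 - 1) * derivative^[k + 2] ((X ^ 2 - 1) ^ n)
      + C (2 * ((k : ℝ) + 1) - 2 * n) * X * derivative^[k + 1] ((X ^ 2 - 1) ^ n)
      + C (((k : ℝ) + 1) * (k - 2 * n)) * derivative^[k] ((X ^ 2 - 1) ^ n) = 0 := by
  induction k with
  | zero =>
    have h : ((X : ℝ[X]) ^ 2 - 1) * derivative ((X ^ 2 - 1) ^ n)
        = C (2 * (n : ℝ)) * X * (X ^ 2 - 1) ^ n := by
      cases n with
      | zero => simp
      | succ n =>
        simp only [derivative_pow_succ, derivative_sub, derivative_X, derivative_one,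
          map_mul, map_add, map_natCast, map_ofNat, map_one, Nat.cast_succ]
        ring
    have h' := congrArg derivative h
    simp only [derivative_mul, derivative_C, derivative_sub, derivative_X_pow, derivative_one,
      derivative_X] at h'
    simp only [Function.iterate_succ_apply', Function.iterate_zero_apply]
    simp only [map_mul, map_sub, map_add, map_natCast, map_ofNat, map_one, Nat.cast_zero,
      Nat.cast_ofNat, map_zero] at h' ⊢
    linear_combination h'
  | succ k ih =>
    have h' := congrArg derivative ih
    simp only [derivative_mul, derivative_C, derivative_sub, derivative_X_pow, derivative_one,
      derivative_X, derivative_add, derivative_zero, ← Function.iterate_succ_apply'] at h'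
    simp only [map_mul, map_sub, map_add, map_natCast, map_ofNat, map_one, Nat.cast_succ]
      at h' ⊢
    linear_combination h'

/-- The `m`-th derivative of Legendre's differential equation. -/
theorem legendre_ode (n m : ℕ) :
    (1 - (X : ℝ[X]) ^ 2) * derivative^[m + 2] (legendre n)
      = C (2 * ((m : ℝ) + 1)) * X * derivative^[m + 1] (legendre n)
        - C (((n : ℝ) - m) * (n + m + 1)) * derivative^[m] (legendre n) := by
  -- Rodrigues' formula already contains `n` derivatives, hence `k = m + n`.
  have h := iterate_derivative_sq_sub_one_pow n (m + n)
  have e : ∀ k, derivative^[k] (legendre n) = C (1 / (2 ^ n * (n.factorial : ℝ))) *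
      derivative^[k + n] (((X : ℝ[X]) ^ 2 - 1) ^ n) := fun k => by
    rw [legendre, iterate_derivative_C_mul, Function.iterate_add_apply]
  rw [e, e, e, show m + 2 + n = m + n + 2 by ring, show m + 1 + n = m + n + 1 by ring]
  simp only [map_mul, map_sub, map_add, map_natCast, map_ofNat, map_one, Nat.cast_add] at h ⊢
  linear_combination (-C (1 / (2 ^ n * (n.factorial : ℝ)))) * h

theorem legendre_eval_one (n : ℕ) : (legendre n).eval 1 = 1 := by
  have h : eval 1 (derivative^[n] (((X : ℝ[X]) ^ 2 - 1) ^ n)) = (n.factorial : ℝ) * 2 ^ n := by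
    -- Around `1` the base becomes `X * (X + 2)`, so the coefficient of `X ^ n` in its `n`-th power
    -- is `2 ^ n`.
    rw [← factorial_smul_hasseDeriv, LinearMap.smul_apply, eval_smul, ← taylor_coeff, taylor_pow]
    have : taylor (1 : ℝ) (X ^ 2 - 1) = X * (X + C 2) := by
      simp only [map_sub, taylor_pow, taylor_X, taylor_one, map_one, map_ofNat]
      ring
    rw [this, mul_pow, coeff_X_pow_mul', if_pos le_rfl, Nat.sub_self, coeff_zero_eq_eval_zero]
    simp
  have h2 := n.factorial_ne_zero
  rw [legendre, eval_mul, eval_C, h]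
  field_simp

theorem natDegree_legendre_le (n : ℕ) : (legendre n).natDegree ≤ n := by
  refine (natDegree_C_mul_le _ _).trans ((natDegree_iterate_derivative _ n).trans ?_)
  have : ((X : ℝ[X]) ^ 2 - 1).natDegree = 2 := by
    simpa using natDegree_X_pow_sub_C (R := ℝ) (n := 2) (r := 1)
  rw [natDegree_pow, this]
  omega

/-! ### The addition theorem by telescoping -/

/-- `(n-m)!/(n+m)! (1-X²)ᵐ (dᵐP_n/dXᵐ)²`, the square of the associated Legendre function
with its factorial normalization. -/
noncomputable def sqAssocLegendre (n m : ℕ) : ℝ[X] :=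
  C (((n - m).factorial : ℝ) / ((n + m).factorial : ℝ)) *
    ((1 - X ^ 2) ^ m * derivative^[m] (legendre n) ^ 2)

/-- The flux whose increments in `m` are the derivatives of `sqAssocLegendre n m`. -/
noncomputable def fluxLegendre (n m : ℕ) : ℝ[X] :=
  C (((n - m).factorial : ℝ) / ((n + m).factorial : ℝ)) *
    ((1 - X ^ 2) ^ m * (derivative^[m] (legendre n) * derivative^[m + 1] (legendre n)))

theorem derivative_sqAssocLegendre_zero (n : ℕ) :
    derivative (sqAssocLegendre n 0) = 2 * fluxLegendre n 0 := by
  simp [sqAssocLegendre, fluxLegendre, derivative_pow, map_ofNat]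
  ring

theorem factorial_ratio_succ {n m : ℕ} (h : m + 1 ≤ n) :
    ((n - m).factorial : ℝ) / ((n + m).factorial : ℝ) =
      ((n - (m + 1)).factorial : ℝ) / ((n + (m + 1)).factorial : ℝ)
        * (((n : ℝ) - m) * (n + m + 1)) := by
  obtain ⟨k, rfl⟩ := Nat.exists_eq_add_of_le h
  have h1 : m + 1 + k - m = k + 1 := by omega
  have h2 : m + 1 + k - (m + 1) = k := by omega
  rw [h1, h2, show m + 1 + k + (m + 1) = (m + 1 + k + m) + 1 by ring, Nat.factorial_succ,
    Nat.factorial_succ]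
  have := (m + 1 + k + m).factorial_ne_zero
  push_cast
  field_simp
  ring

/-- The product rule produces `(1 - X ^ 2) * derivative^[m + 2]` twice. One copy gives the flux at
`m + 1`; Legendre's equation turns the other into the flux at `m`, after its first-order term
cancels the derivative of `(1 - X ^ 2) ^ (m + 1)`. -/
theorem derivative_sqAssocLegendre_succ {n m : ℕ} (h : m + 1 ≤ n) :
    derivative (sqAssocLegendre n (m + 1)) = fluxLegendre n (m + 1) - fluxLegendre n m := by
  have ode := legendre_ode n m
  have hc := congrArg C (factorial_ratio_succ h)
  rw [sqAssocLegendre, fluxLegendre, fluxLegendre, hc]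
  have hd : derivative (derivative^[m + 1] (legendre n) ^ 2)
      = 2 * derivative^[m + 1] (legendre n) * derivative^[m + 2] (legendre n) := by
    rw [derivative_sq, ← Function.iterate_succ_apply' (⇑derivative), map_ofNat]
  have hd' : derivative ((1 - (X : ℝ[X]) ^ 2) ^ (m + 1))
      = -(2 * ((m : ℝ[X]) + 1) * X * (1 - X ^ 2) ^ m) := by
    simp only [derivative_pow_succ, derivative_sub, derivative_X, derivative_one, map_add,
      map_natCast, map_one]
    ring
  simp only [derivative_mul, derivative_C, hd, hd', map_mul, map_add, map_sub, map_natCast,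
    map_ofNat, map_one] at ode ⊢
  linear_combination (C (((n - (m + 1)).factorial : ℝ) / ((n + (m + 1)).factorial : ℝ)) *
    (1 - X ^ 2) ^ m * derivative^[m + 1] (legendre n)) * ode

/-- The addition theorem for spherical harmonics, at coinciding points. -/
theorem sqAssocLegendre_add_sum (n : ℕ) :
    sqAssocLegendre n 0 + 2 * ∑ m ∈ Finset.range n, sqAssocLegendre n (m + 1) = 1 := by
  have hflux : fluxLegendre n n = 0 := by
    have : derivative^[n + 1] (legendre n) = 0 :=
      iterate_derivative_eq_zero (Nat.lt_succ_of_le (natDegree_legendre_le n))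
    simp [fluxLegendre, this]
  have hder : derivative
      (sqAssocLegendre n 0 + 2 * ∑ m ∈ Finset.range n, sqAssocLegendre n (m + 1)) = 0 := by
    have hsum : ∑ m ∈ Finset.range n, derivative (sqAssocLegendre n (m + 1))
        = fluxLegendre n n - fluxLegendre n 0 := by
      rw [← Finset.sum_range_sub]
      exact Finset.sum_congr rfl fun m hm =>
        derivative_sqAssocLegendre_succ (Finset.mem_range.1 hm)
    rw [derivative_add, derivative_mul, derivative_sum, hsum, hflux,
      derivative_sqAssocLegendre_zero, derivative_ofNat]
    ring
  rw [eq_C_of_natDegree_eq_zero (derivative_eq_zero.1 hder),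
    coeff_zero_eq_eval_zero]
  have heval : ∀ p : ℝ[X], derivative p = 0 → p.eval 0 = p.eval 1 := fun p hp => by
    rw [eq_C_of_natDegree_eq_zero (derivative_eq_zero.1 hp)]
    simp
  -- At `1` the factor `(1 - X ^ 2) ^ m` kills every term with `m ≥ 1`.
  rw [heval _ hder]
  have h2 := n.factorial_ne_zero
  simp [sqAssocLegendre, eval_finsetSum, legendre_eval_one, h2]

/-! ### Energy bounds and summability -/

theorem normLegendre_sq (n m : ℕ) {x : ℝ} (hx : x ^ 2 ≤ 1) :
    normLegendre n m x ^ 2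
      = (2 * (n : ℝ) + 1) / (4 * Real.pi) * (sqAssocLegendre n m).eval x := by
  have h : 0 ≤ 1 - x ^ 2 := by linarith
  have h2 : (√(1 - x ^ 2) ^ m) ^ 2 = (1 - x ^ 2) ^ m := by
    rw [← pow_mul, mul_comm, pow_mul, Real.sq_sqrt h]
  have h3 : (((-1 : ℝ)) ^ m) ^ 2 = 1 := by rw [← pow_mul, mul_comm, pow_mul]; simp
  rw [normLegendre, assocLegendre, mul_pow, mul_pow, mul_pow, h2, h3,
    Real.sq_sqrt (by positivity)]
  simp only [sqAssocLegendre, eval_mul, eval_C, eval_pow, eval_sub, eval_one, eval_X]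
  ring

/-- Lets `n` range over all of `ℕ` instead of `n ≥ m`, so that the sums over `n` and `m` can be
exchanged. -/
theorem normLegendre_eq_zero {n m : ℕ} (h : n < m) (x : ℝ) : normLegendre n m x = 0 := by
  simp [normLegendre, assocLegendre,
    iterate_derivative_eq_zero ((natDegree_legendre_le n).trans_lt h)]

theorem sum_normLegendre_sq_le (n : ℕ) {x : ℝ} (hx : x ^ 2 ≤ 1) :
    ∑ m ∈ Finset.range (n + 1), normLegendre n m x ^ 2 ≤ 2 * ((n : ℝ) + 1) := by
  have h := congrArg (eval x) (sqAssocLegendre_add_sum n)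
  simp only [eval_add, eval_mul, eval_finsetSum, eval_one, eval_ofNat] at h
  have hpos : ∀ m, 0 ≤ (sqAssocLegendre n m).eval x := fun m => by
    have : 0 ≤ 1 - x ^ 2 := by linarith
    simp only [sqAssocLegendre, eval_mul, eval_C, eval_pow, eval_sub, eval_one, eval_X]
    positivity
  have hs : ∑ m ∈ Finset.range (n + 1), (sqAssocLegendre n m).eval x ≤ 1 := by
    rw [Finset.sum_range_succ']
    linarith [Finset.sum_nonneg fun m (_ : m ∈ Finset.range n) => hpos (m + 1)]
  have hc : (2 * (n : ℝ) + 1) / (4 * Real.pi) ≤ 2 * ((n : ℝ) + 1) := by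
    rw [div_le_iff₀ (by positivity)]
    nlinarith [Real.pi_gt_three, (Nat.cast_nonneg n : (0 : ℝ) ≤ n)]
  simp only [normLegendre_sq n _ hx, ← Finset.mul_sum]
  calc _ ≤ (2 * (n : ℝ) + 1) / (4 * Real.pi) * 1 := by gcongr
    _ ≤ _ := by linarith

/-- Weighted power spectra with a summable first moment give summable energies. -/
theorem summable_weighted_normLegendre_sq {w : ℕ → ℝ} (hw : ∀ n, 0 ≤ w n)
    (hsum : Summable fun n : ℕ => ((n : ℝ) + 1) * w n) {x : ℝ} (hx : x ^ 2 ≤ 1) :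
    (∀ m, Summable fun n => w n * normLegendre n m x ^ 2) ∧
      Summable fun m => ∑' n, w n * normLegendre n m x ^ 2 := by
  have hfin : ∀ n, HasSum (fun m => w n * normLegendre n m x ^ 2)
      (∑ m ∈ Finset.range (n + 1), w n * normLegendre n m x ^ 2) := fun n =>
    hasSum_sum_of_ne_finset_zero fun m hm => by
      rw [normLegendre_eq_zero (by simpa using hm)]
      simp
  have hpos : ∀ n m, 0 ≤ w n * normLegendre n m x ^ 2 := fun n m =>
    mul_nonneg (hw n) (sq_nonneg _)
  have key : Summable fun p : ℕ × ℕ => w p.1 * normLegendre p.1 p.2 x ^ 2 := by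
    rw [summable_prod_of_nonneg fun p => hpos p.1 p.2]
    refine ⟨fun n => (hfin n).summable, Summable.of_nonneg_of_le
      (fun n => tsum_nonneg (hpos n)) (fun n => ?_) (hsum.mul_left 2)⟩
    rw [(hfin n).tsum_eq, ← Finset.mul_sum]
    linarith [mul_le_mul_of_nonneg_left (sum_normLegendre_sq_le n hx) (hw n)]
  have key' : Summable fun p : ℕ × ℕ => w p.2 * normLegendre p.2 p.1 x ^ 2 := key.prod_symm
  rwa [summable_prod_of_nonneg fun p => hpos p.2 p.1] at key'

theorem summable_pow_mul_of_le_rpow {ξ : ℕ → ℝ} (hξ : ∀ n, 0 ≤ ξ n) {β r : ℝ}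
    {n₀ : ℕ} (hdecay : ∀ n : ℕ, n₀ < n → ξ n ≤ r * (n : ℝ) ^ (-β)) (k : ℕ)
    (hβ : (k : ℝ) + 1 < β) : Summable fun n : ℕ => ((n : ℝ) + 1) ^ k * ξ n := by
  have hs : Summable fun n : ℕ => (2 ^ k * r) * (n : ℝ) ^ ((k : ℝ) - β) :=
    (Real.summable_nat_rpow.2 (by linarith)).mul_left _
  refine hs.of_norm_bounded_eventually_nat ?_
  filter_upwards [Filter.eventually_gt_atTop n₀, Filter.eventually_gt_atTop 0] with n hn hn0
  have hn1 : (1 : ℝ) ≤ n := by exact_mod_cast hn0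
  rw [Real.norm_of_nonneg (mul_nonneg (by positivity) (hξ n))]
  calc ((n : ℝ) + 1) ^ k * ξ n ≤ (2 * (n : ℝ)) ^ k * (r * (n : ℝ) ^ (-β)) := by
        refine mul_le_mul ?_ (hdecay n hn) (hξ n) (by positivity)
        gcongr
        linarith
    _ = _ := by
        rw [sub_eq_add_neg, Real.rpow_add (by linarith), Real.rpow_natCast]
        ring

theorem IsCorrelation.abs_le_one {ρ : ℤ → ℝ} (hρ : IsCorrelation ρ) (h : ℤ) : |ρ h| ≤ 1 := by
  -- The principal minor on the indices `h, 0` is `1 - ρ h ^ 2`.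
  have hdet := (hρ.2.submatrix ![h, 0]).det_nonneg
  have hsymm : ρ (-h) = ρ h := by
    simpa using hρ.2.isHermitian.apply h 0
  rw [Matrix.det_fin_two] at hdet
  simp only [Matrix.submatrix_apply, Matrix.of_apply, Matrix.cons_val_zero, Matrix.cons_val_one,
    sub_self, sub_zero, zero_sub, hρ.1, hsymm] at hdet
  rw [abs_le_one_iff_mul_self_le_one]
  linarith

/-- A summable majorant on `ℕ × ℕ` for each order, with summable sums, gives finite variance at
the given latitude. -/
theorem summable_varianceTerm_of_le {f : ℕ → ℕ → ℕ → ℝ} {L : ℝ} {g : ℕ → ℕ × ℕ → ℝ}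
    (hfg : ∀ m n n', |f m n n' * normLegendre n m (Real.cos L) * normLegendre n' m (Real.cos L)|
      ≤ g m (n, n'))
    (hg : ∀ m, Summable (g m)) (hgs : Summable fun m => ∑' p, g m p) :
    (∀ m, Summable (varianceTerm f L m)) ∧
      Summable fun k : ℕ => 2 * ∑' p, varianceTerm f L (k + 1) p := by
  have hinj : ∀ m : ℕ, Function.Injective
      (Prod.map Subtype.val Subtype.val : Set.Ici m × Set.Ici m → ℕ × ℕ) := fun m =>
    Subtype.val_injective.prodMap Subtype.val_injective
  have hg' : ∀ m, Summable fun p : Set.Ici m × Set.Ici m => g m (p.1, p.2) := fun m =>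
    (hg m).comp_injective (hinj m)
  have hle : ∀ m (p : Set.Ici m × Set.Ici m), ‖varianceTerm f L m p‖ ≤ g m (p.1, p.2) :=
    fun m p => hfg m p.1 p.2
  refine ⟨fun m => (hg' m).of_norm_bounded (hle m), Summable.mul_left 2 ?_⟩
  refine ((summable_nat_add_iff 1).2 hgs).of_norm_bounded fun k =>
    (tsum_of_norm_bounded (hg' _).hasSum (hle (k + 1))).trans ?_
  exact tsum_comp_le_tsum_of_inj (hg (k + 1)) (fun p => (abs_nonneg _).trans (hfg _ p.1 p.2))
    (hinj (k + 1))

end AxialSymmetry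

theorem proposition1 (ξ : ℕ → ℝ) (hξ : ∀ n, 0 ≤ ξ n)
    (ρ : ℤ → ℝ) (hρ : AxialSymmetry.IsCorrelation ρ)
    (lam : ℕ → ℝ) (hlam : ∀ m, 0 ≤ lam m) (hlam_bdd : BddAbove (Set.range lam))
    (β r : ℝ) (hr : 0 < r) (n₀ : ℕ)
    (hdecay : ∀ n : ℕ, n₀ < n → ξ n ≤ r * (n : ℝ) ^ (-β))
    (hβ : 4 < β ∨ (2 < β ∧ ∀ h : ℤ, ρ h = if h = 0 then 1 else 0)) :
    AxialSymmetry.FiniteVariance (AxialSymmetry.spectrum ξ ρ lam) := by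
  intro L _
  open AxialSymmetry in
  suffices ∃ g : ℕ → ℕ × ℕ → ℝ,
      (∀ m n n', |spectrum ξ ρ lam m n n' * normLegendre n m (Real.cos L)
        * normLegendre n' m (Real.cos L)| ≤ g m (n, n')) ∧
      (∀ m, Summable (g m)) ∧ Summable fun m => ∑' p, g m p by
    obtain ⟨g, hfg, hg, hgs⟩ := this
    have h := summable_varianceTerm_of_le hfg hg hgs
    exact ⟨h.1 0, fun m _ => h.1 m, h.2⟩
  obtain ⟨Λ, hΛ⟩ := hlam_bdd
  have hlamΛ : ∀ m, lam m ≤ Λ := fun m => hΛ ⟨m, rfl⟩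
  have hΛ0 : 0 ≤ Λ := (hlam 0).trans (hlamΛ 0)
  have hx : Real.cos L ^ 2 ≤ 1 := Real.cos_sq_le_one L
  have habs : ∀ m n n', |AxialSymmetry.spectrum ξ ρ lam m n n' *
      AxialSymmetry.normLegendre n m (Real.cos L) * AxialSymmetry.normLegendre n' m (Real.cos L)|
      ≤ Λ * (|ρ ((n : ℤ) - n')| * ((√(ξ n) * |AxialSymmetry.normLegendre n m (Real.cos L)|) *
        (√(ξ n') * |AxialSymmetry.normLegendre n' m (Real.cos L)|))) := fun m n n' => by
    rw [AxialSymmetry.spectrum, Real.sqrt_mul (hξ n)]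
    simp only [abs_mul, abs_of_nonneg (Real.sqrt_nonneg _), abs_of_nonneg (hlam m)]
    refine le_of_eq_of_le ?_ (mul_le_mul_of_nonneg_right (hlamΛ m) (by positivity))
    ring
  rcases hβ with hβ | ⟨hβ, hρδ⟩
  · set u : ℕ → ℕ → ℝ := fun m n =>
      (((n : ℝ) + 1) ^ 2 * ξ n) * AxialSymmetry.normLegendre n m (Real.cos L) ^ 2
    -- The weight `(n + 1) ^ 2` is moved onto `ξ` in one variable; its inverse is summable in the
    -- other.
    set v : ℕ → ℝ := fun n => (((n : ℝ) + 1) ^ 2)⁻¹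
    -- Two powers come from the weight, one from the addition theorem.
    have hw := AxialSymmetry.summable_pow_mul_of_le_rpow hξ hdecay 3 (by norm_num; linarith)
    obtain ⟨hu, hus⟩ := AxialSymmetry.summable_weighted_normLegendre_sq
      (w := fun n => ((n : ℝ) + 1) ^ 2 * ξ n) (fun n => mul_nonneg (by positivity) (hξ n))
      (hw.congr fun n => by ring) hx
    have hu0 : ∀ m n, 0 ≤ u m n := fun m n =>
      mul_nonneg (mul_nonneg (by positivity) (hξ n)) (sq_nonneg _)
    have hv0 : ∀ n, 0 ≤ v n := fun n => by positivity
    have hv : Summable v := by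
      have := (summable_nat_add_iff 1).2 (Real.summable_nat_pow_inv (p := 2).2 (by norm_num))
      simpa [v] using this
    have h1 : ∀ m, Summable fun p : ℕ × ℕ => u m p.1 * v p.2 := fun m =>
      (hu m).mul_of_nonneg hv (hu0 m) hv0
    have h2 : ∀ m, Summable fun p : ℕ × ℕ => v p.1 * u m p.2 := fun m =>
      hv.mul_of_nonneg (hu m) hv0 (hu0 m)
    refine ⟨fun m p => Λ * (u m p.1 * v p.2 + v p.1 * u m p.2), fun m n n' => ?_,
      fun m => ((h1 m).add (h2 m)).mul_left Λ, ?_⟩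
    · refine (habs m n n').trans (mul_le_mul_of_nonneg_left ?_ hΛ0)
      -- Weighted AM-GM: the right side is even at least `2 * a * b`.
      have key : ∀ a b s t : ℝ, 0 ≤ a → 0 ≤ b → 0 < s → 0 < t →
          a * b ≤ s * a ^ 2 * t⁻¹ + s⁻¹ * (t * b ^ 2) := fun a b s t ha hb hs ht => by
        have : s * a ^ 2 * t⁻¹ + s⁻¹ * (t * b ^ 2) - 2 * (a * b) =
            (s * t)⁻¹ * (s * a - t * b) ^ 2 := by
          field_simp
          ring
        nlinarith [mul_nonneg ha hb, mul_nonneg (inv_pos.2 (mul_pos hs ht)).le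
          (sq_nonneg (s * a - t * b))]
      refine (mul_le_of_le_one_left (by positivity) (hρ.abs_le_one _)).trans ?_
      refine (key _ _ (((n : ℝ) + 1) ^ 2) (((n' : ℝ) + 1) ^ 2) (by positivity) (by positivity)
        (by positivity) (by positivity)).trans_eq ?_
      simp only [mul_pow, Real.sq_sqrt (hξ _), sq_abs, u, v]
      ring
    · have hsum : ∀ m, ∑' p : ℕ × ℕ, Λ * (u m p.1 * v p.2 + v p.1 * u m p.2)
          = (2 * Λ * ∑' n, v n) * ∑' n, u m n := fun m => by
        rw [tsum_mul_left, (h1 m).tsum_add (h2 m), ← (hu m).tsum_mul_tsum hv (h1 m),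
          ← hv.tsum_mul_tsum (hu m) (h2 m)]
        ring
      simp only [hsum]
      exact hus.mul_left _
  · have hw := AxialSymmetry.summable_pow_mul_of_le_rpow hξ hdecay 1 (by norm_num; linarith)
    obtain ⟨hu, hus⟩ := AxialSymmetry.summable_weighted_normLegendre_sq hξ
      (hw.congr fun n => by ring) hx
    have hdiag : Function.Injective fun n : ℕ => (n, n) := fun a b h => (Prod.ext_iff.1 h).1
    have hsum : ∀ m, HasSum (fun p : ℕ × ℕ => if p.1 = p.2 then
        Λ * (ξ p.1 * AxialSymmetry.normLegendre p.1 m (Real.cos L) ^ 2) else 0)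
        (Λ * ∑' n, ξ n * AxialSymmetry.normLegendre n m (Real.cos L) ^ 2) := fun m => by
      -- The majorant is supported on the diagonal, so its double sum is a single sum over `n`.
      refine (hdiag.hasSum_iff fun p hp => if_neg fun h => hp ⟨p.1, Prod.ext rfl h⟩).1 ?_
      simpa [Function.comp_def] using (hu m).hasSum.mul_left Λ
    refine ⟨_, fun m n n' => (habs m n n').trans ?_, fun m => (hsum m).summable, ?_⟩
    · rw [hρδ]
      by_cases h : n = n'
      · subst h
        rw [if_pos (sub_self _), if_pos rfl, abs_one, one_mul, ← pow_two, mul_pow,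
          Real.sq_sqrt (hξ n), sq_abs]
      · rw [if_neg (by omega), if_neg h]
        simp
    · simp only [fun m => (hsum m).tsum_eq]
      exact hus.mul_left _
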